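/- Let $H, Z, W$ be real Hilbert spaces (of arbitrary dimension), let $Q: H\to Z$, $R: H\to W$ and $\Lambda: H\to\mathbb{R}^m$ ($m\ge 1$) be bounded linear maps, let $\varepsilon,\eta>0$, and let $u_1,\dots,u_m\in H$ satisfy $\Lambda u_i=e_i$, where $(e_1,\dots,e_m)$ is the canonical basis of $\mathbb{R}^m$ (such $u_i$ exist if and only if $\Lambda$ is surjective). The worst-case error of a map $\Delta:\mathbb{R}^m\to Z$ is $$\mathrm{Err}(\Delta)=\sup\{\|Qf-\Delta(\Lambda f+e)\| : f\in H,\ \|Rf\|\le\varepsilon,\ e\in\mathbb{R}^m,\ \|e\|_1\le\eta\}\in[0,\infty].$$ On the Hilbert space $H\times\mathbb{R}$ define $\Gamma(h,\theta)=\Lambda h$, $Q^{(i)}(h,\theta)=Q(h-\theta u_i)$, $R^{(i)}(h,\theta)=\frac1\varepsilon R(h-\theta u_i)$, $S(h,\theta)=\frac1\eta\theta$. By a semidefinite program we mean the minimization of a linear functional over a real vector space subject to finitely many constraints requiring affine functions of the variable, with values in the self-adjoint operators on a Hilbert space or in $\mathbb{R}$, to be positive semidefinite, respectively nonnegative; its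 optimal value is $+\infty$ if it is infeasible. (a) For every linear map $\Delta:\mathbb{R}^m\to Z$, $\mathrm{Err}(\Delta)^2$ equals the optimal value of the semidefinite program $$\min\ \gamma\quad\text{over } \gamma\in\mathbb{R},\ a_1,b_1,\dots,a_m,b_m\ge0$$ subject to, for all $i=1,\dots,m$, $$\begin{bmatrix}\mathrm{Id} & Q^{(i)}-\Delta\Gamma\\ (Q^{(i)}-\Delta\Gamma)^* & a_i{R^{(i)}}^*R^{(i)}+b_iS^*S\end{bmatrix}\succeq0\quad\text{and}\quad a_i+b_i\le\gamma,$$ and the minimum is attained whenever $\mathrm{Err}(\Delta)<\infty$. (b) The same program, with the linear map $\Delta:\mathbb{R}^m\to Z$ as an additional variable, is again a semidefinite program. Its optimal value is $\inf_\Delta\mathrm{Err}(\Delta)^2$, the infimum being over all linear maps $\Delta:\mathbb{R}^m\to Z$; it has a minimizer whenever some linear map has finite worst-case error; and for every minimizer $(\Delta,\gamma,a,b)$, one has $\mathrm{Err}(\Delta)^2=\gamma$ and $\Delta$ has the smallest worst-case error among all linear maps. -/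

import Mathlib

open scoped ENNReal

noncomputable section

namespace LinearRecovery

/-! ### Semidefinite programs -/

/-- A semidefinite program in linear-matrix-inequality form, in coordinate-free notation:
minimize a linear functional of `x : X` subject to finitely many constraints `F i x ⪰ 0`, where
`F i x` is a symmetric operator on the Hilbert space `K` depending affinely on `x`, and finitely
many affine scalar constraints `0 ≤ f k x`. -/
structure SemidefiniteProgram (X ι κ K : Type*) [AddCommGroup X] [Module ℝ X]
    [Finite ι] [Finite κ] [NormedAddCommGroup K] [InnerProductSpace ℝ K] where
  /-- the linear objective -/
  objective : X →ₗ[ℝ] ℝ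
  /-- the operators required to be positive semidefinite -/
  psd : ι → X →ᵃ[ℝ] (K →L[ℝ] K)
  /-- the scalars required to be nonnegative -/
  nonneg : κ → X →ᵃ[ℝ] ℝ
  psd_symmetric : ∀ i x, (psd i x : K →ₗ[ℝ] K).IsSymmetric

namespace SemidefiniteProgram

variable {X ι κ K : Type*} [AddCommGroup X] [Module ℝ X] [Finite ι] [Finite κ]
  [NormedAddCommGroup K] [InnerProductSpace ℝ K]

/-- `x` satisfies all the constraints. -/
def IsFeasible (P : SemidefiniteProgram X ι κ K) (x : X) : Prop :=
  (∀ i, (P.psd i x).IsPositive) ∧ ∀ k, 0 ≤ P.nonneg k x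

/-- The optimal value, i.e. the infimum of the objective over the feasible set
(`⊤` if there is no feasible point, `⊥` if the objective is unbounded below). -/
def value (P : SemidefiniteProgram X ι κ K) : EReal :=
  ⨅ x : {x : X // P.IsFeasible x}, ((P.objective x.1 : ℝ) : EReal)

/-- `x` is a minimizer of the program. -/
def IsMinimizer (P : SemidefiniteProgram X ι κ K) (x : X) : Prop :=
  P.IsFeasible x ∧ ∀ y, P.IsFeasible y → P.objective x ≤ P.objective y

end SemidefiniteProgram

/-! ### Block operators on Hilbert sums -/

section Block

variable {Z K : Type*} [NormedAddCommGroup Z] [InnerProductSpace ℝ Z]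
  [NormedAddCommGroup K] [InnerProductSpace ℝ K]

/-- The operator with block matrix `[A, B; C, D]` on the Hilbert sum of `Z` and `K`:
`(z, g) ↦ (A z + B g, C z + D g)`. -/
def blockOp (A : Z →L[ℝ] Z) (B : K →L[ℝ] Z) (C : Z →L[ℝ] K) (D : K →L[ℝ] K) :
    WithLp 2 (Z × K) →L[ℝ] WithLp 2 (Z × K) :=
  (WithLp.prodContinuousLinearEquiv 2 ℝ Z K).symm.toContinuousLinearMap ∘L
    ((A.coprod B).prod (C.coprod D)) ∘L
      (WithLp.prodContinuousLinearEquiv 2 ℝ Z K).toContinuousLinearMap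

theorem blockOp_apply (A : Z →L[ℝ] Z) (B : K →L[ℝ] Z) (C : Z →L[ℝ] K) (D : K →L[ℝ] K)
    (x : WithLp 2 (Z × K)) :
    blockOp A B C D x = WithLp.toLp 2 (A x.fst + B x.snd, C x.fst + D x.snd) := rfl

theorem blockOp_add (A A' : Z →L[ℝ] Z) (B B' : K →L[ℝ] Z) (C C' : Z →L[ℝ] K)
    (D D' : K →L[ℝ] K) :
    blockOp (A + A') (B + B') (C + C') (D + D') = blockOp A B C D + blockOp A' B' C' D' := by
  refine ContinuousLinearMap.ext fun x => WithLp.ofLp_injective 2 (Prod.ext ?_ ?_)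
  · exact add_add_add_comm (A x.fst) (A' x.fst) (B x.snd) (B' x.snd)
  · exact add_add_add_comm (C x.fst) (C' x.fst) (D x.snd) (D' x.snd)

theorem blockOp_smul (t : ℝ) (A : Z →L[ℝ] Z) (B : K →L[ℝ] Z) (C : Z →L[ℝ] K)
    (D : K →L[ℝ] K) :
    blockOp (t • A) (t • B) (t • C) (t • D) = t • blockOp A B C D := by
  refine ContinuousLinearMap.ext fun x => WithLp.ofLp_injective 2 (Prod.ext ?_ ?_)
  · exact (smul_add t (A x.fst) (B x.snd)).symm
  · exact (smul_add t (C x.fst) (D x.snd)).symm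

end Block

/-! ### Worst-case error under an `ℓ¹`-bounded observation error -/

section Recovery

variable {H Z W : Type*}
  [NormedAddCommGroup H] [InnerProductSpace ℝ H] [CompleteSpace H]
  [NormedAddCommGroup Z] [InnerProductSpace ℝ Z] [CompleteSpace Z]
  [NormedAddCommGroup W] [InnerProductSpace ℝ W] [CompleteSpace W]
  {m : ℕ}

/-- The worst-case error `sup {‖Q f - Δ (Λ f + e)‖ : ‖R f‖ ≤ ε, ‖e‖₁ ≤ η}`, possibly infinite,
of an arbitrary recovery map `Δ`. -/
def worstCaseError (Q : H →L[ℝ] Z) (R : H →L[ℝ] W) (Λ : H →L[ℝ] EuclideanSpace ℝ (Fin m))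
    (ε η : ℝ) (Δ : EuclideanSpace ℝ (Fin m) → Z) : ℝ≥0∞ :=
  ⨆ (f : H) (e : EuclideanSpace ℝ (Fin m)) (_ : ‖R f‖ ≤ ε) (_ : ∑ i, |e i| ≤ η),
    ‖Q f - Δ (Λ f + e)‖ₑ

/-- The extended Hilbert space `H × ℝ`. -/
abbrev Ext (H : Type*) : Type _ := WithLp 2 (H × ℝ)

/-- The map `(h, θ) ↦ h - θ u` on the extended space. -/
def shift (u : H) : Ext H →L[ℝ] H :=
  WithLp.fstL 2 ℝ H ℝ - (WithLp.sndL 2 ℝ H ℝ).smulRight u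

/-- `Γ (h, θ) = Λ h`. -/
def extΓ (Λ : H →L[ℝ] EuclideanSpace ℝ (Fin m)) : Ext H →L[ℝ] EuclideanSpace ℝ (Fin m) :=
  Λ ∘L WithLp.fstL 2 ℝ H ℝ

/-- `Q⁽ʲ⁾ (h, θ) = Q (h - θ u)` with `u = u_j`. -/
def extQ (Q : H →L[ℝ] Z) (u : H) : Ext H →L[ℝ] Z := Q ∘L shift u

/-- `R⁽ʲ⁾ (h, θ) = (1 / ε) R (h - θ u)` with `u = u_j`. -/
def extR (R : H →L[ℝ] W) (ε : ℝ) (u : H) : Ext H →L[ℝ] W := (1 / ε) • (R ∘L shift u)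

/-- `S (h, θ) = (1 / η) θ`. -/
def extS (H : Type*) [NormedAddCommGroup H] [InnerProductSpace ℝ H] (η : ℝ) : Ext H →L[ℝ] ℝ :=
  (1 / η) • WithLp.sndL 2 ℝ H ℝ

/-- The composition `Δ Γ`, depending linearly on the linear map `Δ`. -/
def compΓ (Z : Type*) [NormedAddCommGroup Z] [InnerProductSpace ℝ Z]
    (Λ : H →L[ℝ] EuclideanSpace ℝ (Fin m)) :
    (EuclideanSpace ℝ (Fin m) →ₗ[ℝ] Z) →ₗ[ℝ] (Ext H →L[ℝ] Z) where
  toFun Δ := LinearMap.toContinuousLinearMap Δ ∘L extΓ Λ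
  map_add' _ _ := rfl
  map_smul' _ _ := rfl

/-- The operator `a R⁽ʲ⁾* R⁽ʲ⁾ + b S* S` with `u = u_j`. -/
def quadOp (R : H →L[ℝ] W) (ε η : ℝ) (u : H) (a b : ℝ) : Ext H →L[ℝ] Ext H :=
  a • ((extR R ε u).adjoint ∘L extR R ε u) + b • ((extS H η).adjoint ∘L extS H η)

/-- The block operator
`[Id, Q⁽ʲ⁾ - Δ Γ; (Q⁽ʲ⁾ - Δ Γ)*, a R⁽ʲ⁾* R⁽ʲ⁾ + b S* S]` with `u = u_j`. -/
def schurBlock (Q : H →L[ℝ] Z) (R : H →L[ℝ] W) (Λ : H →L[ℝ] EuclideanSpace ℝ (Fin m))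
    (ε η : ℝ) (u : H) (Δ : EuclideanSpace ℝ (Fin m) →ₗ[ℝ] Z) (a b : ℝ) :
    WithLp 2 (Z × Ext H) →L[ℝ] WithLp 2 (Z × Ext H) :=
  blockOp (ContinuousLinearMap.id ℝ Z) (extQ Q u - compΓ Z Λ Δ)
    (extQ Q u - compΓ Z Λ Δ).adjoint (quadOp R ε η u a b)

theorem schurBlock_symmetric (Q : H →L[ℝ] Z) (R : H →L[ℝ] W)
    (Λ : H →L[ℝ] EuclideanSpace ℝ (Fin m))
    (ε η : ℝ) (u : H) (Δ : EuclideanSpace ℝ (Fin m) →ₗ[ℝ] Z) (a b : ℝ) :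
    (schurBlock Q R Λ ε η u Δ a b :
      WithLp 2 (Z × Ext H) →ₗ[ℝ] WithLp 2 (Z × Ext H)).IsSymmetric := by
  have hD (g g' : Ext H) :
      inner ℝ (quadOp R ε η u a b g) g' = inner ℝ g (quadOp R ε η u a b g') := by
    change inner ℝ (a • (extR R ε u).adjoint (extR R ε u g)
        + b • (extS H η).adjoint (extS H η g)) g'
      = inner ℝ g (a • (extR R ε u).adjoint (extR R ε u g')
        + b • (extS H η).adjoint (extS H η g'))
    rw [inner_add_left, inner_add_right, real_inner_smul_left, real_inner_smul_left,
      real_inner_smul_right, real_inner_smul_right, ContinuousLinearMap.adjoint_inner_left,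
      ContinuousLinearMap.adjoint_inner_left, ContinuousLinearMap.adjoint_inner_right,
      ContinuousLinearMap.adjoint_inner_right]
  intro x y
  generalize hT : extQ Q u - compΓ Z Λ Δ = T
  change inner ℝ (schurBlock Q R Λ ε η u Δ a b x) y = inner ℝ x (schurBlock Q R Λ ε η u Δ a b y)
  rw [WithLp.prod_inner_apply, WithLp.prod_inner_apply, schurBlock, hT]
  change inner ℝ (x.fst + T x.snd) y.fst
      + inner ℝ (T.adjoint x.fst + quadOp R ε η u a b x.snd) y.snd
    = inner ℝ x.fst (y.fst + T y.snd)
      + inner ℝ x.snd (T.adjoint y.fst + quadOp R ε η u a b y.snd)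
  rw [inner_add_left, inner_add_left, inner_add_right, inner_add_right, hD,
    ContinuousLinearMap.adjoint_inner_left, ContinuousLinearMap.adjoint_inner_right]
  ring

/-- The scalar variables `(γ, a, b)` with `a = (a_1, …, a_m)` and `b = (b_1, …, b_m)`. -/
abbrev Vars (m : ℕ) : Type := ℝ × (Fin m → ℝ) × (Fin m → ℝ)

/-- The scalar constraints `0 ≤ a_i`, `0 ≤ b_i` and `0 ≤ γ - (a_i + b_i)`, `i = 1, …, m`. -/
def scalarConstraint (m : ℕ) : Fin m ⊕ Fin m ⊕ Fin m → Vars m →ₗ[ℝ] ℝ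
  | .inl i => { toFun := fun x => x.2.1 i, map_add' := fun _ _ => rfl, map_smul' := fun _ _ => rfl }
  | .inr (.inl i) =>
    { toFun := fun x => x.2.2 i, map_add' := fun _ _ => rfl, map_smul' := fun _ _ => rfl }
  | .inr (.inr i) =>
    { toFun := fun x => x.1 - (x.2.1 i + x.2.2 i)
      map_add' := fun x y => by simp only [Prod.fst_add, Prod.snd_add, Pi.add_apply]; ring
      map_smul' := fun t x => by
        simp only [Prod.smul_fst, Prod.smul_snd, Pi.smul_apply, smul_eq_mul, RingHom.id_apply]
        ring }

/-- The linear part of the block constraint in the variables `(Δ, γ, a, b)`. -/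
def schurBlockLinear (Z : Type*) [NormedAddCommGroup Z] [InnerProductSpace ℝ Z] [CompleteSpace Z]
    (R : H →L[ℝ] W) (Λ : H →L[ℝ] EuclideanSpace ℝ (Fin m)) (ε η : ℝ) (u : H) (i : Fin m) :
    ((EuclideanSpace ℝ (Fin m) →ₗ[ℝ] Z) × Vars m) →ₗ[ℝ]
      (WithLp 2 (Z × Ext H) →L[ℝ] WithLp 2 (Z × Ext H)) where
  toFun x := blockOp 0 (-compΓ Z Λ x.1) (-compΓ Z Λ x.1).adjoint
    (quadOp R ε η u (x.2.2.1 i) (x.2.2.2 i))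
  map_add' x y := by
    rw [← blockOp_add]
    congr 1
    · simp
    · simp [map_add]; abel
    · simp [map_add]; abel
    · simp [quadOp, add_smul]; abel
  map_smul' t x := by
    rw [RingHom.id_apply, ← blockOp_smul]
    congr 1
    · simp
    · simp
    · simp
    · simp [quadOp, mul_smul]

/-- For a fixed linear map `Δ`, the program
`min γ` over `γ ∈ ℝ` and `a_1, b_1, …, a_m, b_m ≥ 0` subject to `a_i + b_i ≤ γ` and
`[Id, Q⁽ⁱ⁾ - Δ Γ; (Q⁽ⁱ⁾ - Δ Γ)*, a_i R⁽ⁱ⁾* R⁽ⁱ⁾ + b_i S* S] ⪰ 0` for all `i`. -/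
def errorSDP (Q : H →L[ℝ] Z) (R : H →L[ℝ] W) (Λ : H →L[ℝ] EuclideanSpace ℝ (Fin m))
    (ε η : ℝ) (u : Fin m → H) (Δ : EuclideanSpace ℝ (Fin m) →ₗ[ℝ] Z) :
    SemidefiniteProgram (Vars m) (Fin m) (Fin m ⊕ Fin m ⊕ Fin m) (WithLp 2 (Z × Ext H)) where
  objective := LinearMap.fst ℝ _ _
  psd i :=
    { toFun := fun x => schurBlock Q R Λ ε η (u i) Δ (x.2.1 i) (x.2.2 i)
      linear := schurBlockLinear Z R Λ ε η (u i) i ∘ₗ LinearMap.inr ℝ _ _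
      map_vadd' := fun x v => by
        simp only [vadd_eq_add, LinearMap.comp_apply, LinearMap.inr_apply, schurBlockLinear,
          LinearMap.coe_mk, AddHom.coe_mk, schurBlock]
        rw [← blockOp_add]
        congr 1
        · simp
        · simp
        · simp
        · simp [quadOp, add_smul]; abel }
  nonneg k := (scalarConstraint m k).toAffineMap
  psd_symmetric i x := schurBlock_symmetric Q R Λ ε η (u i) Δ (x.2.1 i) (x.2.2 i)

/-- The same program in which the linear map `Δ` is a variable as well. -/
def jointSDP (Q : H →L[ℝ] Z) (R : H →L[ℝ] W) (Λ : H →L[ℝ] EuclideanSpace ℝ (Fin m))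
    (ε η : ℝ) (u : Fin m → H) :
    SemidefiniteProgram ((EuclideanSpace ℝ (Fin m) →ₗ[ℝ] Z) × Vars m) (Fin m)
      (Fin m ⊕ Fin m ⊕ Fin m) (WithLp 2 (Z × Ext H)) where
  objective := LinearMap.fst ℝ _ _ ∘ₗ LinearMap.snd ℝ _ _
  psd i :=
    { toFun := fun x => schurBlock Q R Λ ε η (u i) x.1 (x.2.2.1 i) (x.2.2.2 i)
      linear := schurBlockLinear Z R Λ ε η (u i) i
      map_vadd' := fun x v => by
        simp only [vadd_eq_add, schurBlockLinear, LinearMap.coe_mk, AddHom.coe_mk, schurBlock]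
        rw [← blockOp_add]
        congr 1
        · simp
        · simp [map_add]; abel
        · simp [map_add]; abel
        · simp [quadOp, add_smul]; abel }
  nonneg k := (scalarConstraint m k ∘ₗ LinearMap.snd ℝ _ _).toAffineMap
  psd_symmetric i x := schurBlock_symmetric Q R Λ ε η (u i) x.1 (x.2.2.1 i) (x.2.2.2 i)

end Recovery

end LinearRecovery

end

open LinearRecovery

namespace LinearRecovery

/-! ### Yuan's lemma for two quadratic forms. -/

section QuadraticForms

variable {V : Type*} [AddCommGroup V] [Module ℝ V]

/-! For fixed `Δ` the vector `Q f - Δ (Λ f + e)` is affine in `e`, so a bound on its norm over the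
`ℓ¹` ball need only be checked for `e = θ e_i`. Putting `f = h - θ u_i` turns `Λ f + e` into `Λ h`:
the error becomes a linear map `T` of `g = (h, θ)`, and homogeneity turns the bound into `‖T g‖² ≤ γ
max (‖R⁽ⁱ⁾ g‖²) (‖S g‖²)` (`forall_norm_sq_le_iff`). Only two quadratic forms compete in the
maximum, so Yuan's lemma replaces it, without loss and in any dimension, by `a ‖R⁽ⁱ⁾ g‖² + b ‖S g‖²`
with `a + b ≤ γ` (`exists_multipliers_iff`). Completing the square makes this the block constraint
(`schurBlock_isPositive_iff`).

Every step is an equivalence at each `γ ≥ 0`, in particular at the squared error itself when it is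
finite; hence attainment for fixed `Δ`. Attainment over `Δ` needs a best linear map
(`exists_worstCaseError_minimal`), found in the intersection of nested bounded closed convex
sublevel sets. -/

theorem quadraticForm_apply_combination (F : QuadraticForm ℝ V) (r s : ℝ) (x y : V) :
    F (r • x + s • y) = r ^ 2 * F x + r * s * QuadraticMap.polar F x y + s ^ 2 * F y := by
  rw [QuadraticMap.map_add F, QuadraticMap.map_smul, QuadraticMap.map_smul,
    QuadraticMap.polar_smul_left, QuadraticMap.polar_smul_right]
  simp only [smul_eq_mul]
  ring

/-- The segment from `x` to `y` is covered by the closed sets where `F ≥ 0` and where `G ≥ 0`, both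
nonempty, so by connectedness both forms are nonnegative at some point of it. There the combination
with weight `t` is nonnegative too; but its expansion has negative end terms and a nonpositive cross
term. -/
theorem not_neg_of_max_nonneg_of_polar_nonpos (F G : QuadraticForm ℝ V)
    (h : ∀ x, 0 ≤ F x ∨ 0 ≤ G x) {t : ℝ} (ht : t ∈ Set.Icc (0 : ℝ) 1) {x y : V}
    (hFx : F x < 0) (hGy : G y < 0) (hx : t * F x + (1 - t) * G x < 0)
    (hy : t * F y + (1 - t) * G y < 0)
    (hp : t * QuadraticMap.polar F x y + (1 - t) * QuadraticMap.polar G x y ≤ 0) : False := by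
  have hcont (K : QuadraticForm ℝ V) :
      Continuous fun s : ℝ => K ((1 - s) • x + s • y) := by
    simp only [quadraticForm_apply_combination]
    fun_prop
  have hGx : 0 ≤ G x := (h x).resolve_left hFx.not_ge
  have hFy : 0 ≤ F y := (h y).resolve_right hGy.not_ge
  obtain ⟨s, hs, hsF, hsG⟩ := isPreconnected_closed_iff.1
    (isPreconnected_Icc (a := (0 : ℝ)) (b := 1))
    {s | 0 ≤ F ((1 - s) • x + s • y)} {s | 0 ≤ G ((1 - s) • x + s • y)}
    (isClosed_le continuous_const (hcont F)) (isClosed_le continuous_const (hcont G))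
    (fun s _ => h _) ⟨1, by simp, by simpa using hFy⟩ ⟨0, by simp, by simpa using hGx⟩
  simp only [Set.mem_ofPred_eq, quadraticForm_apply_combination] at hsF hsG
  obtain ⟨ht0, ht1⟩ := ht
  obtain ⟨hs0, hs1⟩ := hs
  have hsum := add_nonneg (mul_nonneg ht0 hsF) (mul_nonneg (sub_nonneg.2 ht1) hsG)
  have hpol : (1 - s) * s *
      (t * QuadraticMap.polar F x y + (1 - t) * QuadraticMap.polar G x y) ≤ 0 :=
    mul_nonpos_of_nonneg_of_nonpos (mul_nonneg (sub_nonneg.2 hs1) hs0) hp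
  have hxle : (1 - s) ^ 2 * (t * F x + (1 - t) * G x) ≤ 0 :=
    mul_nonpos_of_nonneg_of_nonpos (sq_nonneg _) hx.le
  have hyle : s ^ 2 * (t * F y + (1 - t) * G y) ≤ 0 :=
    mul_nonpos_of_nonneg_of_nonpos (sq_nonneg _) hy.le
  rcases hs0.eq_or_lt with rfl | hs0
  · norm_num at hsum
    linarith
  · have : s ^ 2 * (t * F y + (1 - t) * G y) < 0 := mul_neg_of_pos_of_neg (by positivity) hy
    linarith

/-- **Yuan's lemma**: if at each point one of two real quadratic forms is nonnegative, then some
convex combination of the two forms is positive semidefinite. -/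
theorem exists_convex_combination_nonneg (F G : QuadraticForm ℝ V)
    (h : ∀ x, 0 ≤ F x ∨ 0 ≤ G x) :
    ∃ t ∈ Set.Icc (0 : ℝ) 1, ∀ x, 0 ≤ t * F x + (1 - t) * G x := by
  by_contra! hne
  -- The weights whose failure is witnessed where `F < 0`, and those witnessed where `G < 0`, form
  -- two open sets covering `[0, 1]`; connectedness gives a weight with witnesses of both kinds.
  have hopen (K : QuadraticForm ℝ V) :
      IsOpen {t : ℝ | ∃ x, K x < 0 ∧ t * F x + (1 - t) * G x < 0} := by
    have : {t : ℝ | ∃ x, K x < 0 ∧ t * F x + (1 - t) * G x < 0} =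
        ⋃ x : {x // K x < 0}, {t : ℝ | t * F x + (1 - t) * G x < 0} := by
      ext t
      simp
    rw [this]
    exact isOpen_iUnion fun x => isOpen_lt (by fun_prop) continuous_const
  have hcover : Set.Icc (0 : ℝ) 1 ⊆ {t | ∃ x, F x < 0 ∧ t * F x + (1 - t) * G x < 0} ∪
      {t | ∃ x, G x < 0 ∧ t * F x + (1 - t) * G x < 0} := by
    intro t ht
    obtain ⟨x, hx⟩ := hne t ht
    by_cases hF : F x < 0
    · exact Or.inl ⟨x, hF, hx⟩
    · refine Or.inr ⟨x, lt_of_not_ge fun hG => ?_, hx⟩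
      have := mul_nonneg ht.1 (not_lt.1 hF)
      have := mul_nonneg (sub_nonneg.2 ht.2) hG
      linarith
  obtain ⟨x₁, hx₁⟩ := hne 1 (by simp)
  obtain ⟨x₀, hx₀⟩ := hne 0 (by simp)
  obtain ⟨t, ht, ⟨x, hFx, hx⟩, y, hGy, hy⟩ := isPreconnected_Icc (a := (0 : ℝ)) (b := 1) _ _
    (hopen F) (hopen G) hcover ⟨1, by simp, x₁, by simpa using hx₁, hx₁⟩
    ⟨0, by simp, x₀, by simpa using hx₀, hx₀⟩
  -- Replacing `y` by `-y` keeps all values of the forms and flips the cross term, so its sign may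
  -- be assumed.
  rcases le_total (t * QuadraticMap.polar F x y + (1 - t) * QuadraticMap.polar G x y) 0 with hp | hp
  · exact not_neg_of_max_nonneg_of_polar_nonpos F G h ht hFx hGy hx hy hp
  · refine not_neg_of_max_nonneg_of_polar_nonpos F G h ht (y := -y) hFx (by simpa using hGy) hx
      (by simpa using hy) ?_
    rw [QuadraticMap.polar_neg_right, QuadraticMap.polar_neg_right]
    linarith

end QuadraticForms

/-! ### Nested convex sets in a Hilbert space. -/

section NestedConvex

/-- A decreasing sequence of nonempty, closed, convex and bounded sets in a Hilbert space has
nonempty intersection. -/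
theorem nonempty_iInter_of_convex_of_isBounded {E : Type*} [NormedAddCommGroup E]
    [InnerProductSpace ℝ E] [CompleteSpace E] (C : ℕ → Set E) (hanti : Antitone C)
    (hne : ∀ n, (C n).Nonempty) (hclosed : ∀ n, IsClosed (C n)) (hconv : ∀ n, Convex ℝ (C n))
    (hbdd : Bornology.IsBounded (C 0)) : (⋂ n, C n).Nonempty := by
  have hmin (n : ℕ) : ∃ x ∈ C n, ∀ y ∈ C n, ‖x‖ ≤ ‖y‖ := by
    obtain ⟨x, hx, hxinf⟩ :=
      exists_norm_eq_iInf_of_complete_convex (hne n) (hclosed n).isComplete (hconv n) 0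
    refine ⟨x, hx, fun y hy => ?_⟩
    have hle := ciInf_le (f := fun w : C n => ‖(0 : E) - w‖)
      ⟨0, by rintro _ ⟨w, rfl⟩; exact norm_nonneg _⟩ ⟨y, hy⟩
    rw [← hxinf] at hle
    simpa using hle
  choose x hxC hxmin using hmin
  obtain ⟨M, hM⟩ := hbdd.exists_norm_le
  have hmono : Monotone fun n => ‖x n‖ ^ 2 := fun n k hnk =>
    pow_le_pow_left₀ (norm_nonneg _) (hxmin n _ (hanti hnk (hxC k))) 2
  have hlim := tendsto_atTop_ciSup hmono ⟨M ^ 2, by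
    rintro _ ⟨n, rfl⟩
    exact pow_le_pow_left₀ (norm_nonneg _) (hM _ (hanti (Nat.zero_le n) (hxC n))) 2⟩
  -- The midpoint of `x n` and `x k` lies in `C n`, so its norm is at least `‖x n‖`; the
  -- parallelogram law does the rest.
  have hdist (n k : ℕ) (hnk : n ≤ k) : ‖x n - x k‖ ^ 2 ≤ 2 * (‖x k‖ ^ 2 - ‖x n‖ ^ 2) := by
    have hmid : (1 / 2 : ℝ) • x n + (1 / 2 : ℝ) • x k ∈ C n :=
      hconv n (hxC n) (hanti hnk (hxC k)) (by norm_num) (by norm_num) (by norm_num)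
    have hle := hxmin n _ hmid
    rw [← smul_add, norm_smul] at hle
    norm_num at hle
    have hpar := parallelogram_law_with_norm ℝ (x n) (x k)
    nlinarith [norm_nonneg (x n)]
  have hcauchy : CauchySeq x := by
    rw [Metric.cauchySeq_iff']
    intro δ hδ
    obtain ⟨N, hN⟩ := Metric.cauchySeq_iff'.1 hlim.cauchySeq (δ ^ 2 / 2) (by positivity)
    refine ⟨N, fun n hn => ?_⟩
    have h1 := (le_abs_self _).trans_lt ((Real.dist_eq _ _).symm.trans_lt (hN n hn))
    have h2 := hdist N n hn
    rw [dist_comm, dist_eq_norm]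
    exact lt_of_pow_lt_pow_left₀ 2 hδ.le (by linarith)
  obtain ⟨y, hy⟩ := cauchySeq_tendsto_of_complete hcauchy
  exact ⟨y, Set.mem_iInter.2 fun n => (hclosed n).mem_of_tendsto hy
    (Filter.eventually_atTop.2 ⟨n, fun k hk => hanti hk (hxC k)⟩)⟩

end NestedConvex

/-! ### Reduction to the extended space, multipliers, and a best linear map. -/

section WorstCaseError

variable {H Z W : Type*}
  [NormedAddCommGroup H] [InnerProductSpace ℝ H]
  [NormedAddCommGroup Z] [InnerProductSpace ℝ Z]
  [NormedAddCommGroup W] [InnerProductSpace ℝ W]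
  {m : ℕ}

theorem worstCaseError_le_iff (Q : H →L[ℝ] Z) (R : H →L[ℝ] W)
    (Λ : H →L[ℝ] EuclideanSpace ℝ (Fin m)) (ε η : ℝ) (Δ : EuclideanSpace ℝ (Fin m) → Z)
    {c : ℝ} (hc : 0 ≤ c) :
    worstCaseError Q R Λ ε η Δ ≤ ENNReal.ofReal c ↔
      ∀ (f : H) (e : EuclideanSpace ℝ (Fin m)), ‖R f‖ ≤ ε → ∑ i, |e i| ≤ η →
        ‖Q f - Δ (Λ f + e)‖ ≤ c := by
  simp only [worstCaseError, iSup_le_iff, ← ofReal_norm,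
    ENNReal.ofReal_le_ofReal_iff hc]

theorem worstCaseError_sq_le_iff (Q : H →L[ℝ] Z) (R : H →L[ℝ] W)
    (Λ : H →L[ℝ] EuclideanSpace ℝ (Fin m)) (ε η : ℝ) (Δ : EuclideanSpace ℝ (Fin m) → Z)
    {γ : ℝ} (hγ : 0 ≤ γ) :
    worstCaseError Q R Λ ε η Δ ^ 2 ≤ ENNReal.ofReal γ ↔
      ∀ (f : H) (e : EuclideanSpace ℝ (Fin m)), ‖R f‖ ≤ ε → ∑ i, |e i| ≤ η →
        ‖Q f - Δ (Λ f + e)‖ ^ 2 ≤ γ := by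
  have h : ENNReal.ofReal γ = ENNReal.ofReal √γ ^ 2 := by
    rw [← ENNReal.ofReal_pow (Real.sqrt_nonneg γ), Real.sq_sqrt hγ]
  rw [h, ENNReal.pow_le_pow_left_iff two_ne_zero,
    worstCaseError_le_iff _ _ _ _ _ _ (Real.sqrt_nonneg γ)]
  simp only [Real.le_sqrt (norm_nonneg _) hγ]

/-- A norm bound on `v - θ w_i` for all indices `i` and `|θ| ≤ η` extends to the convex hull,
i.e. to all `v - ∑ e_i w_i` with `∑ |e_i| ≤ η`. -/
theorem norm_sub_sum_le_of_single {ι : Type*} [Fintype ι] [Nonempty ι] {η c : ℝ} (hη : 0 < η)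
    (v : Z) (w : ι → Z) (h : ∀ i (θ : ℝ), |θ| ≤ η → ‖v - θ • w i‖ ≤ c)
    (e : ι → ℝ) (he : ∑ i, |e i| ≤ η) : ‖v - ∑ i, e i • w i‖ ≤ c := by
  have hs (i : ι) : |η * SignType.sign (e i)| ≤ η := by
    rcases lt_trichotomy (e i) 0 with h | h | h <;> simp [h, abs_of_pos hη, hη.le]
  have hv : ‖v‖ ≤ c := by simpa using h (Classical.arbitrary ι) 0 (by simpa using hη.le)
  have hsum : ∑ i, |e i| / η ≤ 1 := by
    rw [← Finset.sum_div]
    exact (div_le_one hη).2 he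
  -- A convex combination of the points with `θ = ± η`; the weight left over when `∑ |e i| < η` goes
  -- to `v`, the case `θ = 0`.
  have heq : v - ∑ i, e i • w i = (1 - ∑ i, |e i| / η) • v +
      ∑ i, (|e i| / η) • (v - (η * SignType.sign (e i)) • w i) := by
    have (i : ι) : (|e i| / η) • (v - (η * SignType.sign (e i)) • w i) =
        (|e i| / η) • v - e i • w i := by
      rw [smul_sub, smul_smul]
      congr 2
      rw [div_mul_eq_mul_div, mul_left_comm, mul_div_cancel_left₀ _ hη.ne', abs_mul_sign]
    simp only [this, Finset.sum_sub_distrib, ← Finset.sum_smul, sub_smul, one_smul]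
    abel
  rw [heq]
  calc _ ≤ ‖(1 - ∑ i, |e i| / η) • v‖ +
        ∑ i, ‖(|e i| / η) • (v - (η * SignType.sign (e i)) • w i)‖ :=
        (norm_add_le _ _).trans (by gcongr; exact norm_sum_le _ _)
    _ ≤ (1 - ∑ i, |e i| / η) * c + ∑ i, |e i| / η * c := by
        gcongr with i
        · rw [norm_smul, Real.norm_of_nonneg (sub_nonneg.2 hsum)]
          exact mul_le_mul_of_nonneg_left hv (sub_nonneg.2 hsum)
        · have h0 : 0 ≤ |e i| / η := by positivity
          rw [norm_smul, Real.norm_of_nonneg h0]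
          exact mul_le_mul_of_nonneg_left (h i _ (hs i)) h0
    _ = c := by rw [← Finset.sum_mul]; ring

theorem linearMap_apply_eq_sum (Δ : EuclideanSpace ℝ (Fin m) →ₗ[ℝ] Z)
    (e : EuclideanSpace ℝ (Fin m)) :
    Δ e = ∑ i, e i • Δ (EuclideanSpace.single i (1 : ℝ)) := by
  conv_lhs => rw [← (EuclideanSpace.basisFun (Fin m) ℝ).sum_repr e]
  simp

/-- The worst-case error of a linear map in terms of the extended space. -/
theorem forall_norm_sq_le_iff (hm : 1 ≤ m) (Q : H →L[ℝ] Z) (R : H →L[ℝ] W)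
    (Λ : H →L[ℝ] EuclideanSpace ℝ (Fin m)) {ε η : ℝ} (hε : 0 < ε) (hη : 0 < η)
    (u : Fin m → H) (hu : ∀ j, Λ (u j) = EuclideanSpace.single j (1 : ℝ))
    (Δ : EuclideanSpace ℝ (Fin m) →ₗ[ℝ] Z) {γ : ℝ} (hγ : 0 ≤ γ) :
    (∀ (f : H) (e : EuclideanSpace ℝ (Fin m)), ‖R f‖ ≤ ε → ∑ i, |e i| ≤ η →
        ‖Q f - Δ (Λ f + e)‖ ^ 2 ≤ γ) ↔
      ∀ i g, ‖(extQ Q (u i) - compΓ Z Λ Δ) g‖ ^ 2 ≤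
        γ * max (‖extR R ε (u i) g‖ ^ 2) (‖extS H η g‖ ^ 2) := by
  have hT (i : Fin m) (g : Ext H) : (extQ Q (u i) - compΓ Z Λ Δ) g =
      Q (g.fst - g.snd • u i) - Δ (Λ g.fst) := rfl
  have hR (i : Fin m) (g : Ext H) : ‖extR R ε (u i) g‖ = ‖R (g.fst - g.snd • u i)‖ / ε := by
    change ‖(1 / ε) • R (g.fst - g.snd • u i)‖ = _
    rw [norm_smul, Real.norm_of_nonneg (by positivity)]
    ring
  have hS (g : Ext H) : ‖extS H η g‖ = |g.snd| / η := by
    change ‖(1 / η) • g.snd‖ = _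
    rw [norm_smul, Real.norm_of_nonneg (by positivity), Real.norm_eq_abs]
    ring
  constructor
  · intro h i g
    -- Scaling by `s⁻¹` makes the pair admissible, and `Λ (u i) = e_i` cancels the observation error
    -- against the shift.
    have hscale (s : ℝ) (hs : 0 < s) (h1 : ‖extR R ε (u i) g‖ ≤ s) (h2 : ‖extS H η g‖ ≤ s) :
        ‖(extQ Q (u i) - compΓ Z Λ Δ) g‖ ^ 2 ≤ γ * s ^ 2 := by
      rw [hR, div_le_iff₀ hε] at h1
      rw [hS, div_le_iff₀ hη] at h2
      have := h (s⁻¹ • (g.fst - g.snd • u i)) (EuclideanSpace.single i (s⁻¹ * g.snd))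
        (by
          rw [map_smul, norm_smul, Real.norm_of_nonneg (by positivity), inv_mul_le_iff₀ hs]
          exact h1)
        (by
          rw [Finset.sum_eq_single i (by intro j _ hj; simp [hj]) (by simp)]
          simp only [PiLp.single_apply, if_true, abs_mul, abs_inv, abs_of_pos hs]
          rw [inv_mul_le_iff₀ hs]
          exact h2)
      have hsing : EuclideanSpace.single i (s⁻¹ * g.snd) =
          s⁻¹ • g.snd • EuclideanSpace.single i (1 : ℝ) := by
        ext j
        by_cases hj : j = i <;> simp [hj]
      have heq : Q (s⁻¹ • (g.fst - g.snd • u i)) -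
          Δ (Λ (s⁻¹ • (g.fst - g.snd • u i)) + EuclideanSpace.single i (s⁻¹ * g.snd)) =
          s⁻¹ • (extQ Q (u i) - compΓ Z Λ Δ) g := by
        rw [hT, hsing, map_smul, map_smul, ← smul_add, map_smul, ← smul_sub, map_sub Λ, map_smul Λ,
          hu, sub_add_cancel]
      rw [heq, norm_smul, Real.norm_of_nonneg (by positivity), mul_pow, inv_pow,
        inv_mul_le_iff₀ (by positivity)] at this
      linarith
    -- The maximum may vanish, so the scale is taken slightly larger. Dividing `δ` by `γ + 1` keeps
    -- `γ` times the excess below `δ` and is safe at `γ = 0`.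
    refine le_of_forall_pos_le_add fun δ hδ => ?_
    set M := max (‖extR R ε (u i) g‖ ^ 2) (‖extS H η g‖ ^ 2) with hM
    have hM0 : 0 ≤ M := le_max_of_le_left (sq_nonneg _)
    have hpos : 0 < M + δ / (γ + 1) := by positivity
    have := hscale √(M + δ / (γ + 1)) (Real.sqrt_pos.2 hpos)
      (Real.le_sqrt_of_sq_le ((le_max_left _ _).trans (le_add_of_nonneg_right (by positivity))))
      (Real.le_sqrt_of_sq_le ((le_max_right _ _).trans (le_add_of_nonneg_right (by positivity))))
    rw [Real.sq_sqrt hpos.le, mul_add] at this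
    refine this.trans ?_
    gcongr
    rw [mul_div_assoc', div_le_iff₀ (by positivity)]
    nlinarith
  · intro h f e hf he
    have : Nonempty (Fin m) := ⟨⟨0, hm⟩⟩
    rw [← Real.le_sqrt (norm_nonneg _) hγ, map_add, linearMap_apply_eq_sum Δ e, ← sub_sub]
    refine norm_sub_sum_le_of_single hη _ _ (fun i θ hθ => Real.le_sqrt_of_sq_le ?_) _ he
    -- The shift sends this point back to `f`, while `Γ` sends it to `Λ f + θ e_i`.
    have hi := h i (WithLp.toLp 2 (f + θ • u i, θ))
    simp only [hT, hR, hS, WithLp.toLp_fst, WithLp.toLp_snd, add_sub_cancel_right, map_add,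
      map_smul, hu, ← sub_sub] at hi
    refine hi.trans (mul_le_of_le_one_right hγ (max_le ?_ ?_))
    · exact pow_le_one₀ (by positivity) ((div_le_one hε).2 hf)
    · exact pow_le_one₀ (by positivity) ((div_le_one hη).2 hθ)

/-- The quadratic form `g ↦ ‖L g‖²`. -/
noncomputable def normSqForm {K E : Type*} [NormedAddCommGroup K] [InnerProductSpace ℝ K]
    [NormedAddCommGroup E] [InnerProductSpace ℝ E] (L : K →L[ℝ] E) : QuadraticForm ℝ K :=
  (LinearMap.BilinMap.toQuadraticMap (innerₗ E)).comp (L : K →ₗ[ℝ] E)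

theorem normSqForm_apply {K E : Type*} [NormedAddCommGroup K] [InnerProductSpace ℝ K]
    [NormedAddCommGroup E] [InnerProductSpace ℝ E] (L : K →L[ℝ] E) (g : K) :
    normSqForm L g = ‖L g‖ ^ 2 := real_inner_self_eq_norm_sq _

/-- The S-lemma for two nonnegative quadratic constraints. -/
theorem exists_multipliers_iff {K Y : Type*} [NormedAddCommGroup K] [InnerProductSpace ℝ K]
    [NormedAddCommGroup Y] [InnerProductSpace ℝ Y]
    (T : K →L[ℝ] Z) (A : K →L[ℝ] W) (B : K →L[ℝ] Y) {γ : ℝ} (hγ : 0 ≤ γ) :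
    (∀ g, ‖T g‖ ^ 2 ≤ γ * max (‖A g‖ ^ 2) (‖B g‖ ^ 2)) ↔
      ∃ a b : ℝ, 0 ≤ a ∧ 0 ≤ b ∧ a + b ≤ γ ∧
        ∀ g, ‖T g‖ ^ 2 ≤ a * ‖A g‖ ^ 2 + b * ‖B g‖ ^ 2 := by
  constructor
  · intro h
    -- At each `g` the maximum equals one of its two entries, which is the alternative Yuan's lemma
    -- requires.
    obtain ⟨t, ht, hpos⟩ := exists_convex_combination_nonneg
      (γ • normSqForm A - normSqForm T) (γ • normSqForm B - normSqForm T) (fun g => by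
        simp only [sub_apply, smul_apply, normSqForm_apply, smul_eq_mul, sub_nonneg]
        rcases max_choice (‖A g‖ ^ 2) (‖B g‖ ^ 2) with h' | h'
        · exact Or.inl (h' ▸ h g)
        · exact Or.inr (h' ▸ h g))
    refine ⟨γ * t, γ * (1 - t), mul_nonneg hγ ht.1, mul_nonneg hγ (sub_nonneg.2 ht.2),
      (by linarith), fun g => ?_⟩
    have := hpos g
    simp only [sub_apply, smul_apply, normSqForm_apply, smul_eq_mul] at this
    linarith
  · rintro ⟨a, b, ha, hb, hab, h⟩ g
    refine (h g).trans ?_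
    have h0 : 0 ≤ max (‖A g‖ ^ 2) (‖B g‖ ^ 2) := le_max_of_le_left (sq_nonneg _)
    calc _ ≤ a * max (‖A g‖ ^ 2) (‖B g‖ ^ 2) + b * max (‖A g‖ ^ 2) (‖B g‖ ^ 2) := by
          gcongr
          · exact le_max_left _ _
          · exact le_max_right _ _
      _ ≤ _ := by
          rw [← add_mul]
          gcongr

/-- The worst-case error attains its infimum over the linear maps. -/
theorem exists_worstCaseError_minimal [CompleteSpace Z] (Q : H →L[ℝ] Z) (R : H →L[ℝ] W)
    (Λ : H →L[ℝ] EuclideanSpace ℝ (Fin m)) {ε η : ℝ} (hε : 0 < ε) (hη : 0 < η) :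
    ∃ Δ : EuclideanSpace ℝ (Fin m) →ₗ[ℝ] Z, ∀ Δ' : EuclideanSpace ℝ (Fin m) →ₗ[ℝ] Z,
      worstCaseError Q R Λ ε η Δ ≤ worstCaseError Q R Λ ε η Δ' := by
  -- Linear maps are encoded by their columns, so that they range over the Hilbert space `Z^m`.
  let L (v : PiLp 2 fun _ : Fin m => Z) : EuclideanSpace ℝ (Fin m) →ₗ[ℝ] Z :=
    ∑ i, (EuclideanSpace.projₗ i : EuclideanSpace ℝ (Fin m) →ₗ[ℝ] ℝ).smulRight (v i)
  have hL (v : PiLp 2 fun _ : Fin m => Z) (e : EuclideanSpace ℝ (Fin m)) :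
      L v e = ∑ i, e i • v i := by simp [L]
  have hsurj (Δ : EuclideanSpace ℝ (Fin m) →ₗ[ℝ] Z) : ∃ v, L v = Δ :=
    ⟨WithLp.toLp 2 fun i => Δ (EuclideanSpace.single i 1), LinearMap.ext fun e => by
      rw [hL, linearMap_apply_eq_sum Δ e]⟩
  set c : ℝ≥0∞ := ⨅ Δ : EuclideanSpace ℝ (Fin m) →ₗ[ℝ] Z, worstCaseError Q R Λ ε η Δ with hc
  by_cases hctop : c = ⊤
  · exact ⟨0, fun Δ' => by
      rw [hc, iInf_eq_top] at hctop
      rw [hctop Δ']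
      exact le_top⟩
  let δ (n : ℕ) : ℝ := c.toReal + 1 / ((n : ℝ) + 1)
  have hδ0 (n : ℕ) : 0 ≤ δ n := by positivity
  have hδc (n : ℕ) : c < ENNReal.ofReal (δ n) := by
    rw [ENNReal.lt_ofReal_iff_toReal_lt hctop]
    exact lt_add_of_pos_right _ (by positivity)
  let C (n : ℕ) : Set (PiLp 2 fun _ : Fin m => Z) :=
    {v | ∀ (f : H) (e : EuclideanSpace ℝ (Fin m)), ‖R f‖ ≤ ε → ∑ i, |e i| ≤ η →
      ‖Q f - ∑ i, (Λ f + e) i • v i‖ ≤ δ n}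
  have hC (n : ℕ) (v : PiLp 2 fun _ : Fin m => Z) :
      v ∈ C n ↔ worstCaseError Q R Λ ε η (L v) ≤ ENNReal.ofReal (δ n) := by
    rw [worstCaseError_le_iff _ _ _ _ _ _ (hδ0 n)]
    simp only [hL]
    rfl
  have hanti : Antitone C := fun n k hnk v hv f e hf he =>
    (hv f e hf he).trans (by simp only [δ]; gcongr)
  have hne (n : ℕ) : (C n).Nonempty := by
    obtain ⟨Δ, hΔ⟩ := iInf_lt_iff.1 (hδc n)
    obtain ⟨v, rfl⟩ := hsurj Δ
    exact ⟨v, (hC n v).2 hΔ.le⟩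
  have hclosed (n : ℕ) : IsClosed (C n) := by
    simp only [C, Set.ofPred_forall]
    refine isClosed_iInter fun f => isClosed_iInter fun e => isClosed_iInter fun _ =>
      isClosed_iInter fun _ => isClosed_le ?_ continuous_const
    fun_prop
  have hconv (n : ℕ) : Convex ℝ (C n) := by
    intro v hv w hw s t hs ht hst f e hf he
    have heq : Q f - ∑ i, (Λ f + e) i • (s • v + t • w) i =
        s • (Q f - ∑ i, (Λ f + e) i • v i) + t • (Q f - ∑ i, (Λ f + e) i • w i) := by
      have : ∑ i, (Λ f + e) i • (s • v + t • w) i =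
          s • ∑ i, (Λ f + e) i • v i + t • ∑ i, (Λ f + e) i • w i := by
        rw [Finset.smul_sum, Finset.smul_sum, ← Finset.sum_add_distrib]
        refine Finset.sum_congr rfl fun i _ => ?_
        change _ • (s • v i + t • w i) = _
        rw [smul_add, smul_comm s, smul_comm t]
      rw [this, smul_sub, smul_sub, sub_add_sub_comm, ← add_smul, hst, one_smul]
    rw [heq, ← mem_closedBall_zero_iff]
    exact convex_closedBall (0 : Z) (δ n) (mem_closedBall_zero_iff.2 (hv f e hf he))
      (mem_closedBall_zero_iff.2 (hw f e hf he)) hs ht hst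
  -- Testing with `f = 0` and `e = η e_i` bounds the `i`-th column by `δ 0 / η`.
  have hbdd : Bornology.IsBounded (C 0) := by
    refine isBounded_iff_forall_norm_le.2 ⟨√(∑ _i : Fin m, (δ 0 / η) ^ 2), fun v hv => ?_⟩
    rw [PiLp.norm_eq_of_L2]
    refine Real.sqrt_le_sqrt (Finset.sum_le_sum fun i _ => ?_)
    refine pow_le_pow_left₀ (norm_nonneg _) ((le_div_iff₀ hη).2 ?_) 2
    have hi := hv 0 (EuclideanSpace.single i η) (by simpa using hε.le)
      (by
        rw [Finset.sum_eq_single i (by intro j _ hj; simp [hj]) (by simp)]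
        simp [abs_of_pos hη])
    rw [Finset.sum_eq_single i (by intro j _ hj; simp [hj]) (by simp)] at hi
    simpa [norm_smul, abs_of_pos hη, mul_comm] using hi
  obtain ⟨v, hv⟩ := nonempty_iInter_of_convex_of_isBounded C hanti hne hclosed hconv hbdd
  refine ⟨L v, fun Δ' => le_trans ?_ (hc.le.trans (iInf_le _ Δ'))⟩
  refine ge_of_tendsto' (f := fun n : ℕ => ENNReal.ofReal (δ n)) (x := Filter.atTop) ?_
    fun n => (hC n v).1 (Set.mem_iInter.1 hv n)
  have : Filter.Tendsto δ Filter.atTop (nhds c.toReal) := by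
    simpa [δ] using (tendsto_const_nhds (x := c.toReal)).add
      (tendsto_one_div_add_atTop_nhds_zero_nat (𝕜 := ℝ))
  simpa [ENNReal.ofReal_toReal hctop] using ENNReal.tendsto_ofReal this

end WorstCaseError

/-! ### Completing the square in the block operator. -/

section Schur

variable {Z K : Type*} [NormedAddCommGroup Z] [InnerProductSpace ℝ Z] [CompleteSpace Z]
  [NormedAddCommGroup K] [InnerProductSpace ℝ K] [CompleteSpace K]

theorem inner_blockOp_adjoint (T : K →L[ℝ] Z) (D : K →L[ℝ] K) (x : WithLp 2 (Z × K)) :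
    inner ℝ (blockOp (ContinuousLinearMap.id ℝ Z) T T.adjoint D x) x =
      ‖x.fst + T x.snd‖ ^ 2 + (inner ℝ (D x.snd) x.snd - ‖T x.snd‖ ^ 2) := by
  rw [WithLp.prod_inner_apply]
  change inner ℝ (x.fst + T x.snd) x.fst + inner ℝ (T.adjoint x.fst + D x.snd) x.snd = _
  rw [inner_add_left, inner_add_left, ContinuousLinearMap.adjoint_inner_left, norm_add_sq_real,
    real_inner_self_eq_norm_sq, real_inner_comm x.fst]
  ring

end Schur

/-! ### Feasible points and optimal values of the two programs. -/

section Recovery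

variable {H Z W : Type*}
  [NormedAddCommGroup H] [InnerProductSpace ℝ H] [CompleteSpace H]
  [NormedAddCommGroup Z] [InnerProductSpace ℝ Z] [CompleteSpace Z]
  [NormedAddCommGroup W] [InnerProductSpace ℝ W] [CompleteSpace W]
  {m : ℕ}

theorem inner_quadOp (R : H →L[ℝ] W) (ε η : ℝ) (u : H) (a b : ℝ) (g : Ext H) :
    inner ℝ (quadOp R ε η u a b g) g = a * ‖extR R ε u g‖ ^ 2 + b * ‖extS H η g‖ ^ 2 := by
  change inner ℝ (a • (extR R ε u).adjoint (extR R ε u g)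
    + b • (extS H η).adjoint (extS H η g)) g = _
  rw [inner_add_left, real_inner_smul_left, real_inner_smul_left,
    ContinuousLinearMap.adjoint_inner_left, ContinuousLinearMap.adjoint_inner_left,
    real_inner_self_eq_norm_sq, real_inner_self_eq_norm_sq]

theorem schurBlock_isPositive_iff (Q : H →L[ℝ] Z) (R : H →L[ℝ] W)
    (Λ : H →L[ℝ] EuclideanSpace ℝ (Fin m)) (ε η : ℝ) (u : H)
    (Δ : EuclideanSpace ℝ (Fin m) →ₗ[ℝ] Z) (a b : ℝ) :
    (schurBlock Q R Λ ε η u Δ a b).IsPositive ↔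
      ∀ g, ‖(extQ Q u - compΓ Z Λ Δ) g‖ ^ 2 ≤
        a * ‖extR R ε u g‖ ^ 2 + b * ‖extS H η g‖ ^ 2 := by
  have key (x : WithLp 2 (Z × Ext H)) :
      (schurBlock Q R Λ ε η u Δ a b).reApplyInnerSelf x =
        ‖x.fst + (extQ Q u - compΓ Z Λ Δ) x.snd‖ ^ 2 +
          (a * ‖extR R ε u x.snd‖ ^ 2 + b * ‖extS H η x.snd‖ ^ 2 -
            ‖(extQ Q u - compΓ Z Λ Δ) x.snd‖ ^ 2) := by
    rw [← inner_quadOp]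
    exact inner_blockOp_adjoint _ _ x
  constructor
  · intro h g
    -- The choice `z = -T g` annihilates the completed square.
    have := h.2 (WithLp.toLp 2 (-((extQ Q u - compΓ Z Λ Δ) g), g))
    rw [key] at this
    simp only [WithLp.toLp_fst, WithLp.toLp_snd, neg_add_cancel, norm_zero] at this
    linarith
  · intro h
    refine ⟨schurBlock_symmetric Q R Λ ε η u Δ a b, fun x => ?_⟩
    rw [key]
    have := h x.snd
    have := sq_nonneg ‖x.fst + (extQ Q u - compΓ Z Λ Δ) x.snd‖
    linarith

theorem errorSDP_isFeasible_iff (Q : H →L[ℝ] Z) (R : H →L[ℝ] W)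
    (Λ : H →L[ℝ] EuclideanSpace ℝ (Fin m)) (ε η : ℝ) (u : Fin m → H)
    (Δ : EuclideanSpace ℝ (Fin m) →ₗ[ℝ] Z) (x : Vars m) :
    (errorSDP Q R Λ ε η u Δ).IsFeasible x ↔
      ∀ i, 0 ≤ x.2.1 i ∧ 0 ≤ x.2.2 i ∧ x.2.1 i + x.2.2 i ≤ x.1 ∧
        ∀ g, ‖(extQ Q (u i) - compΓ Z Λ Δ) g‖ ^ 2 ≤
          x.2.1 i * ‖extR R ε (u i) g‖ ^ 2 + x.2.2 i * ‖extS H η g‖ ^ 2 := by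
  have hpsd (i : Fin m) := schurBlock_isPositive_iff Q R Λ ε η (u i) Δ (x.2.1 i) (x.2.2 i)
  constructor
  · rintro ⟨h1, h2⟩ i
    exact ⟨h2 (.inl i), h2 (.inr (.inl i)), sub_nonneg.1 (h2 (.inr (.inr i))), (hpsd i).1 (h1 i)⟩
  · intro h
    refine ⟨fun i => (hpsd i).2 (h i).2.2.2, ?_⟩
    rintro (i | i | i)
    · exact (h i).1
    · exact (h i).2.1
    · exact sub_nonneg.2 (h i).2.2.1

/-- `γ` is the objective value of a feasible point exactly when it bounds the squared error. -/
theorem exists_isFeasible_iff (hm : 1 ≤ m) (Q : H →L[ℝ] Z) (R : H →L[ℝ] W)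
    (Λ : H →L[ℝ] EuclideanSpace ℝ (Fin m)) {ε η : ℝ} (hε : 0 < ε) (hη : 0 < η)
    (u : Fin m → H) (hu : ∀ j, Λ (u j) = EuclideanSpace.single j (1 : ℝ))
    (Δ : EuclideanSpace ℝ (Fin m) →ₗ[ℝ] Z) (γ : ℝ) :
    (∃ ab, (errorSDP Q R Λ ε η u Δ).IsFeasible (γ, ab)) ↔
      0 ≤ γ ∧ worstCaseError Q R Λ ε η Δ ^ 2 ≤ ENNReal.ofReal γ := by
  simp only [errorSDP_isFeasible_iff]
  constructor
  · rintro ⟨ab, h⟩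
    have hγ : 0 ≤ γ := by
      obtain ⟨h1, h2, h3, -⟩ := h ⟨0, hm⟩
      exact (add_nonneg h1 h2).trans h3
    rw [worstCaseError_sq_le_iff _ _ _ _ _ _ hγ, forall_norm_sq_le_iff hm Q R Λ hε hη u hu Δ hγ]
    exact ⟨hγ, fun i => (exists_multipliers_iff _ _ _ hγ).2 ⟨_, _, h i⟩⟩
  · rintro ⟨hγ, h⟩
    rw [worstCaseError_sq_le_iff _ _ _ _ _ _ hγ,
      forall_norm_sq_le_iff hm Q R Λ hε hη u hu Δ hγ] at h
    choose a b hab using fun i => (exists_multipliers_iff _ _ _ hγ).1 (h i)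
    exact ⟨(a, b), hab⟩

theorem worstCaseError_sq_le_of_isFeasible (hm : 1 ≤ m) (Q : H →L[ℝ] Z) (R : H →L[ℝ] W)
    (Λ : H →L[ℝ] EuclideanSpace ℝ (Fin m)) {ε η : ℝ} (hε : 0 < ε) (hη : 0 < η)
    (u : Fin m → H) (hu : ∀ j, Λ (u j) = EuclideanSpace.single j (1 : ℝ))
    (Δ : EuclideanSpace ℝ (Fin m) →ₗ[ℝ] Z) {x : Vars m}
    (hx : (errorSDP Q R Λ ε η u Δ).IsFeasible x) :
    0 ≤ x.1 ∧ worstCaseError Q R Λ ε η Δ ^ 2 ≤ ENNReal.ofReal x.1 :=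
  (exists_isFeasible_iff hm Q R Λ hε hη u hu Δ x.1).1 ⟨x.2, hx⟩

theorem exists_isFeasible_of_ne_top (hm : 1 ≤ m) (Q : H →L[ℝ] Z) (R : H →L[ℝ] W)
    (Λ : H →L[ℝ] EuclideanSpace ℝ (Fin m)) {ε η : ℝ} (hε : 0 < ε) (hη : 0 < η)
    (u : Fin m → H) (hu : ∀ j, Λ (u j) = EuclideanSpace.single j (1 : ℝ))
    (Δ : EuclideanSpace ℝ (Fin m) →ₗ[ℝ] Z) (h : worstCaseError Q R Λ ε η Δ ≠ ⊤) :
    ∃ ab, (errorSDP Q R Λ ε η u Δ).IsFeasible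
      ((worstCaseError Q R Λ ε η Δ ^ 2).toReal, ab) :=
  (exists_isFeasible_iff hm Q R Λ hε hη u hu Δ _).2
    ⟨ENNReal.toReal_nonneg, (ENNReal.ofReal_toReal (ENNReal.pow_ne_top h)).ge⟩

theorem coe_le_coe_of_le_ofReal {c : ℝ≥0∞} {γ : ℝ} (hγ : 0 ≤ γ) (h : c ≤ ENNReal.ofReal γ) :
    (c : EReal) ≤ (γ : EReal) := by
  calc (c : EReal) ≤ (ENNReal.ofReal γ : ℝ≥0∞) := EReal.coe_ennreal_le_coe_ennreal_iff.2 h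
    _ = γ := by rw [EReal.coe_ennreal_ofReal, max_eq_left hγ]

theorem errorSDP_value (hm : 1 ≤ m) (Q : H →L[ℝ] Z) (R : H →L[ℝ] W)
    (Λ : H →L[ℝ] EuclideanSpace ℝ (Fin m)) {ε η : ℝ} (hε : 0 < ε) (hη : 0 < η)
    (u : Fin m → H) (hu : ∀ j, Λ (u j) = EuclideanSpace.single j (1 : ℝ))
    (Δ : EuclideanSpace ℝ (Fin m) →ₗ[ℝ] Z) :
    ((worstCaseError Q R Λ ε η Δ ^ 2 : ℝ≥0∞) : EReal) = (errorSDP Q R Λ ε η u Δ).value := by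
  refine le_antisymm (le_iInf fun x => ?_) ?_
  · obtain ⟨h0, h⟩ := worstCaseError_sq_le_of_isFeasible hm Q R Λ hε hη u hu Δ x.2
    exact coe_le_coe_of_le_ofReal h0 h
  · by_cases h : worstCaseError Q R Λ ε η Δ = ⊤
    · simp [h]
    · obtain ⟨ab, hab⟩ := exists_isFeasible_of_ne_top hm Q R Λ hε hη u hu Δ h
      refine (iInf_le _ ⟨_, hab⟩).trans (le_of_eq ?_)
      exact EReal.coe_ennreal_toReal (ENNReal.pow_ne_top h)

/-- Feasibility of `(Δ, x)` here unfolds to feasibility of `x` for that `Δ`, so this is an iterated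
infimum. -/
theorem jointSDP_value (Q : H →L[ℝ] Z) (R : H →L[ℝ] W)
    (Λ : H →L[ℝ] EuclideanSpace ℝ (Fin m)) (ε η : ℝ) (u : Fin m → H) :
    (jointSDP Q R Λ ε η u).value =
      ⨅ Δ : EuclideanSpace ℝ (Fin m) →ₗ[ℝ] Z, (errorSDP Q R Λ ε η u Δ).value :=
  le_antisymm (le_iInf fun Δ => le_iInf fun x => iInf_le_of_le ⟨(Δ, x.1), x.2⟩ le_rfl)
    (le_iInf fun x => iInf_le_of_le x.1.1 (iInf_le_of_le ⟨x.1.2, x.2⟩ le_rfl))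

end Recovery

end LinearRecovery

theorem mainTheorem8 {H Z W : Type*}
    [NormedAddCommGroup H] [InnerProductSpace ℝ H] [CompleteSpace H]
    [NormedAddCommGroup Z] [InnerProductSpace ℝ Z] [CompleteSpace Z]
    [NormedAddCommGroup W] [InnerProductSpace ℝ W] [CompleteSpace W]
    {m : ℕ} (hm : 1 ≤ m)
    (Q : H →L[ℝ] Z) (R : H →L[ℝ] W) (Λ : H →L[ℝ] EuclideanSpace ℝ (Fin m))
    (ε η : ℝ) (hε : 0 < ε) (hη : 0 < η)
    (u : Fin m → H) (hu : ∀ j, Λ (u j) = EuclideanSpace.single j (1 : ℝ)) :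
    -- a fixed linear map: the squared error is the optimal value, attained when it is finite
    (∀ Δ : EuclideanSpace ℝ (Fin m) →ₗ[ℝ] Z,
      ((worstCaseError Q R Λ ε η Δ ^ 2 : ℝ≥0∞) : EReal) = (errorSDP Q R Λ ε η u Δ).value ∧
      (worstCaseError Q R Λ ε η Δ ≠ ⊤ → ∃ x, (errorSDP Q R Λ ε η u Δ).IsMinimizer x)) ∧
    -- the minimization over all linear maps is a semidefinite program too
    (((⨅ Δ : EuclideanSpace ℝ (Fin m) →ₗ[ℝ] Z, worstCaseError Q R Λ ε η Δ ^ 2 : ℝ≥0∞) : EReal) =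
        (jointSDP Q R Λ ε η u).value ∧
      ((∃ Δ : EuclideanSpace ℝ (Fin m) →ₗ[ℝ] Z, worstCaseError Q R Λ ε η Δ ≠ ⊤) →
        ∃ x, (jointSDP Q R Λ ε η u).IsMinimizer x) ∧
      ∀ x, (jointSDP Q R Λ ε η u).IsMinimizer x →
        ((worstCaseError Q R Λ ε η x.1 ^ 2 : ℝ≥0∞) : EReal) =
            (((jointSDP Q R Λ ε η u).objective x : ℝ) : EReal) ∧
        ∀ Δ : EuclideanSpace ℝ (Fin m) →ₗ[ℝ] Z,
          worstCaseError Q R Λ ε η x.1 ≤ worstCaseError Q R Λ ε η Δ) := by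
  refine ⟨fun Δ => ⟨errorSDP_value hm Q R Λ hε hη u hu Δ, fun h => ?_⟩, ?_, ?_, fun x hx => ?_⟩
  · obtain ⟨ab, hab⟩ := exists_isFeasible_of_ne_top hm Q R Λ hε hη u hu Δ h
    refine ⟨_, hab, fun y hy => ?_⟩
    obtain ⟨h0, hle⟩ := worstCaseError_sq_le_of_isFeasible hm Q R Λ hε hη u hu Δ hy
    exact ENNReal.toReal_le_of_le_ofReal h0 hle
  · rw [jointSDP_value]
    simp only [← errorSDP_value hm Q R Λ hε hη u hu]
    -- A minimizing map lets the coercion to `EReal` pass through the infimum.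
    obtain ⟨Δ, hΔ⟩ := exists_worstCaseError_minimal Q R Λ hε hη
    refine le_antisymm (le_iInf fun Δ' => EReal.coe_ennreal_le_coe_ennreal_iff.2 (iInf_le _ Δ'))
      (iInf_le_of_le Δ (EReal.coe_ennreal_le_coe_ennreal_iff.2 (le_iInf fun Δ' => ?_)))
    exact pow_le_pow_left' (hΔ Δ') 2
  · rintro ⟨Δ₀, h₀⟩
    obtain ⟨Δ, hΔ⟩ := exists_worstCaseError_minimal Q R Λ hε hη
    obtain ⟨ab, hab⟩ := exists_isFeasible_of_ne_top hm Q R Λ hε hη u hu Δ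
      ((hΔ Δ₀).trans_lt h₀.lt_top).ne
    refine ⟨(Δ, _, ab), hab, fun y hy => ?_⟩
    obtain ⟨h0, hle⟩ := worstCaseError_sq_le_of_isFeasible hm Q R Λ hε hη u hu y.1 hy
    exact ENNReal.toReal_le_of_le_ofReal h0 ((pow_le_pow_left' (hΔ y.1) 2).trans hle)
  · obtain ⟨h0, hle⟩ := worstCaseError_sq_le_of_isFeasible hm Q R Λ hε hη u hu x.1 hx.1
    -- When its error is finite, each `Δ` extends to a feasible point whose objective is its squared
    -- error; compare with the minimizer.
    have hmin (Δ : EuclideanSpace ℝ (Fin m) →ₗ[ℝ] Z) :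
        ENNReal.ofReal x.2.1 ≤ worstCaseError Q R Λ ε η Δ ^ 2 := by
      by_cases h : worstCaseError Q R Λ ε η Δ = ⊤
      · simp [h]
      · obtain ⟨ab, hab⟩ := exists_isFeasible_of_ne_top hm Q R Λ hε hη u hu Δ h
        exact ENNReal.ofReal_le_of_le_toReal (hx.2 (Δ, _, ab) hab)
    refine ⟨?_, fun Δ => (ENNReal.pow_le_pow_left_iff two_ne_zero).1 (hle.trans (hmin Δ))⟩
    rw [le_antisymm hle (hmin x.1), EReal.coe_ennreal_ofReal, max_eq_left h0]
    rfl
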